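/- Let $F$ be an infinite field, let $n \ge 1$ and $k \ge 0$ be integers, and let $X_1,\ldots,X_k$ be sets. For a set $X$, the generic $n\times n$ matrix algebra $F_n\langle X\rangle$ is the unital $F$-subalgebra of $M_n\big(F[t^{(x)}_{ij} : x\in X,\ 1\le i,j\le n]\big)$ (matrices over the polynomial ring in commuting indeterminates $t^{(x)}_{ij}$) generated by the generic matrices $\big(t^{(x)}_{ij}\big)_{1\le i,j\le n}$, $x\in X$. Then the tensor product over $F$ $$F_n\langle X_1\rangle\otimes_F\cdots\otimes_F F_n\langle X_k\rangle$$ is a (right) Ore domain; that is, it is a nonzero ring without zero divisors, and any two nonzero elements $a,b$ of this ring $R$ satisfy $aR\cap bR\neq 0$. -/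

import Mathlib

open scoped TensorProduct

/-- The generic `n × n` matrix attached to the variable `x ∈ X`: its entries are the pairwise
distinct commuting indeterminates `t_{ij}^{(x)}`, one for each triple `(x, i, j)`. -/
noncomputable def genericMatrix (F : Type*) [Field F] (n : ℕ) {X : Type*} (x : X) :
    Matrix (Fin n) (Fin n) (MvPolynomial (X × Fin n × Fin n) F) :=
  Matrix.of fun i j => MvPolynomial.X (x, i, j)

/-- The generic `n × n` matrix algebra `F_n⟨X⟩`: the unital `F`-subalgebra of the algebra of
`n × n` matrices over the polynomial ring `F[t_{ij}^{(x)}]` that is generated by the generic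
matrices `(t_{ij}^{(x)})`, for `x ∈ X`. -/
noncomputable abbrev genericMatrixAlgebra (F : Type*) [Field F] (n : ℕ) (X : Type*) :
    Subalgebra F (Matrix (Fin n) (Fin n) (MvPolynomial (X × Fin n × Fin n) F)) :=
  Algebra.adjoin F (Set.range fun x : X => genericMatrix F n x)

/-- A (right) Ore domain: a domain `R` (nontrivial, without zero divisors, not necessarily
commutative) such that `aR ∩ bR ≠ 0` for all nonzero `a` and `b`. -/
structure IsOreDomain (R : Type*) [Ring R] : Prop extends IsDomain R where
  /-- Any two nonzero elements have a nonzero common right multiple. -/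
  exists_common_multiple : ∀ a b : R, a ≠ 0 → b ≠ 0 → ∃ r s : R, a * r = b * s ∧ a * r ≠ 0

/-! Weight `t_{ij}` by `z ^ ((j - i) mod n)` and split each generic matrix along its cyclic
diagonals: it becomes a sum of monomial matrices. These come from the monoid `S` of monomials
extended by cyclic shifts, and `F[S]` acts faithfully by monomial matrices, so the generic matrix
algebra embeds in `F[S]` (`exists_injective_to_monoidAlgebra`). Over a field the tensor product then
embeds in the algebra of a finite product of such monoids. Unique products make that algebra a
domain, and the product action embeds it in matrices over a commutative ring.

A domain inside such matrices is Ore (`isOreDomain_of_injective_matrix`): otherwise the `a ^ i * b`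
would generate a free algebra, contradicting the standard identity. -/

/-! ### Ore condition from the standard identity -/

/-- In a domain where `a` and `b` have no nonzero common right multiple, the elements
`a ^ i * b` are right linearly independent. -/
theorem pow_mul_right_independent {R : Type*} [Ring R] [IsDomain R] {a b : R} (ha : a ≠ 0)
    (hb : b ≠ 0) (h : ∀ r s : R, a * r = b * s → a * r = 0) (m : ℕ) (r : Fin m → R)
    (hr : ∑ i : Fin m, a ^ (i : ℕ) * b * r i = 0) : r = 0 := by
  induction m with
  | zero => exact Subsingleton.elim _ _
  | succ m ih =>
    rw [Fin.sum_univ_succ] at hr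
    have hsum : ∑ i : Fin m, a ^ ((i.succ : Fin (m + 1)) : ℕ) * b * r i.succ =
        a * ∑ i : Fin m, a ^ (i : ℕ) * b * r i.succ := by
      simp only [Finset.mul_sum, Fin.val_succ, pow_succ', mul_assoc]
    rw [hsum] at hr
    simp only [Fin.val_zero, pow_zero, one_mul] at hr
    have h1 := h (∑ i : Fin m, a ^ (i : ℕ) * b * r i.succ) (-r 0)
      (by rw [mul_neg]; exact eq_neg_of_add_eq_zero_right hr)
    have h2 := ih (fun i => r i.succ) ((mul_eq_zero.mp h1).resolve_left ha)
    rw [h1, add_zero] at hr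
    funext i
    refine Fin.cases ?_ (fun j => ?_) i
    · exact (mul_eq_zero.mp hr).resolve_left hb
    · exact congrFun h2 j

/-- If a finite family is right linearly independent, so are its words of any fixed length. -/
theorem word_right_independent {R ι : Type*} [Ring R] [Fintype ι] {x : ι → R}
    (hx : ∀ r : ι → R, ∑ i, x i * r i = 0 → r = 0) (m : ℕ) (c : (Fin m → ι) → R)
    (hc : ∑ w, (List.ofFn fun i => x (w i)).prod * c w = 0) : c = 0 := by
  induction m with
  | zero =>
    funext w
    simpa [Subsingleton.elim w default] using hc
  | succ m ih =>
    rw [← (Fin.consEquiv fun _ => ι).sum_comp, Fintype.sum_prod_type] at hc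
    have h1 := hx (fun i => ∑ w : Fin m → ι,
      (List.ofFn fun j => x (w j)).prod * c (Fin.cons i w)) (by
        simpa [Finset.mul_sum, List.ofFn_succ, mul_assoc, Fin.consEquiv] using hc)
    funext w
    rw [← Fin.cons_self_tail w]
    exact congrFun (ih (fun v => c (Fin.cons (w 0) v)) (congrFun h1 (w 0))) _

/-- Matrices over a commutative ring satisfy the standard identity of every degree exceeding the
rank of the matrix algebra. -/
theorem matrix_standard_identity {C E : Type*} [CommRing C] [Fintype E] [DecidableEq E] {m : ℕ}
    (hm : Fintype.card (E × E) < m) (x : Fin m → Matrix E E C) :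
    ∑ σ : Equiv.Perm (Fin m),
      ((σ.sign : ℤ) : Matrix E E C) * (List.ofFn fun i => x (σ i)).prod = 0 := by
  -- An alternating map with more arguments than there are matrix units vanishes, since basis
  -- arguments must repeat.
  have h : MultilinearMap.alternatization (MultilinearMap.mkPiAlgebraFin C m (Matrix E E C)) = 0 :=
    Module.Basis.ext_alternating (Matrix.stdBasis C E E) fun v hv => by
      exact absurd (Fintype.card_le_of_injective v hv) (by simpa using hm)
  have := DFunLike.congr_fun h x
  simpa [MultilinearMap.alternatization_apply, Units.smul_def] using this

/-- A domain that embeds in a matrix ring over a commutative ring is a right Ore domain. -/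
theorem isOreDomain_of_injective_matrix {R C E : Type*} [Ring R] [IsDomain R] [CommRing C]
    [Fintype E] [DecidableEq E] (φ : R →+* Matrix E E C) (hφ : Function.Injective φ) :
    IsOreDomain R where
  exists_common_multiple a b ha hb := by
    by_contra! h
    classical
    set m := Fintype.card (E × E) + 1
    have hx := pow_mul_right_independent ha hb h m
    have hid : ∑ σ : Equiv.Perm (Fin m),
        ((σ.sign : ℤ) : R) * (List.ofFn fun i => a ^ ((σ i : Fin m) : ℕ) * b).prod = 0 := by
      apply hφ
      have := matrix_standard_identity (C := C) (E := E) (Nat.lt_succ_self _)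
        (fun i : Fin m => φ (a ^ (i : ℕ) * b))
      simpa [map_sum, map_list_prod, List.map_ofFn, Function.comp_def] using this
    -- The identity is a relation between words with coefficient `sign σ` on the word of `σ` and 0
    -- on words with repeats; the word of the identity permutation has coefficient 1.
    have h0 := word_right_independent hx m
      (fun w => ∑ σ : Equiv.Perm (Fin m), if ⇑σ = w then ((σ.sign : ℤ) : R) else 0) (by
        refine Eq.trans ?_ hid
        simp_rw [Finset.mul_sum]
        rw [Finset.sum_comm]
        refine Finset.sum_congr rfl fun σ _ => ?_
        rw [Finset.sum_eq_single (⇑σ) (fun w _ hw => by rw [if_neg hw.symm, mul_zero])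
          (fun hσ => absurd (Finset.mem_univ _) hσ), if_pos rfl, (Int.cast_commute _ _).eq])
    have h1 := congrFun h0 ⇑(1 : Equiv.Perm (Fin m))
    rw [Finset.sum_eq_single 1 (fun σ _ hσ => if_neg fun h => hσ (DFunLike.coe_injective h))
      (fun hσ => absurd (Finset.mem_univ _) hσ), if_pos rfl] at h1
    simp at h1

/-! ### Monomial representations -/

/-- A right action of a monoid `N` on a set `E` together with a multiplicative cocycle with values
in a commutative monoid `W`. -/
structure MonomialAction (N E W : Type*) [Monoid N] [CommMonoid W] where
  /-- the right action -/
  act : E → N → E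
  /-- the cocycle -/
  weight : E → N → W
  act_one : ∀ e, act e 1 = e
  act_mul : ∀ e x y, act e (x * y) = act (act e x) y
  weight_one : ∀ e, weight e 1 = 1
  weight_mul : ∀ e x y, weight e (x * y) = weight e x * weight (act e x) y

namespace MonomialAction

variable {N E W : Type*} [Monoid N] [CommMonoid W]

/-- The product of a family of monomial actions. -/
def pi {ι : Type*} {N E W : ι → Type*} [∀ i, Monoid (N i)] [∀ i, CommMonoid (W i)]
    (α : ∀ i, MonomialAction (N i) (E i) (W i)) :
    MonomialAction (∀ i, N i) (∀ i, E i) (∀ i, W i) where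
  act e x i := (α i).act (e i) (x i)
  weight e x i := (α i).weight (e i) (x i)
  act_one _ := funext fun i => (α i).act_one _
  act_mul _ _ _ := funext fun i => (α i).act_mul _ _ _
  weight_one _ := funext fun i => (α i).weight_one _
  weight_mul _ _ _ := funext fun i => (α i).weight_mul _ _ _

variable [Fintype E] [DecidableEq E] (F : Type*) [Field F] (α : MonomialAction N E W)

/-- The representation of `F[N]` by monomial matrices over `F[W]`. -/
noncomputable def rep : MonoidAlgebra F N →ₐ[F] Matrix E E (MonoidAlgebra F W) :=
  MonoidAlgebra.lift F _ N
    { toFun x := Matrix.of fun e e' =>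
        if α.act e x = e' then MonoidAlgebra.single (α.weight e x) 1 else 0
      map_one' := by
        ext1 e e'
        simp [α.act_one, α.weight_one, Matrix.one_apply, MonoidAlgebra.one_def]
      map_mul' x y := by
        ext1 e e'
        simp only [α.act_mul, α.weight_mul, Matrix.mul_apply, Matrix.of_apply]
        rw [Finset.sum_eq_single (α.act e x) (fun j _ hj => by rw [if_neg hj.symm, zero_mul])
          (fun h => absurd (Finset.mem_univ _) h)]
        simp [MonoidAlgebra.single_mul_single] }

theorem rep_single (x : N) (c : F) (e e' : E) :
    α.rep F (MonoidAlgebra.single x c) e e' =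
      if α.act e x = e' then MonoidAlgebra.single (α.weight e x) c else 0 := by
  simp [rep, MonoidAlgebra.lift_single]

/-- A monomial matrix has one nonzero entry per row, so summing a row forgets the position and keeps
the weight. One row thus suffices for faithfulness. -/
theorem sum_rep_apply (r : MonoidAlgebra F N) (e : E) :
    ∑ e', α.rep F r e e' = MonoidAlgebra.mapDomain (α.weight e) r := by
  induction r using MonoidAlgebra.induction_linear with
  | zero => simp
  | add f g hf hg => simp [Finset.sum_add_distrib, hf, hg, MonoidAlgebra.mapDomain_add]
  | single x c => simp [rep_single, MonoidAlgebra.mapDomain_single]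

theorem rep_injective (e : E) (he : Function.Injective (α.weight e)) :
    Function.Injective (α.rep F) := fun r s h =>
  MonoidAlgebra.mapDomain_injective he (by rw [← sum_rep_apply, ← sum_rep_apply, h])

end MonomialAction

/-! ### Cyclic shifts and the shift monoid -/

/-- The cyclic shift of `Fin n` by `j`. -/
def cyclicShift {n : ℕ} (j : ℕ) (a : Fin n) : Fin n :=
  ⟨(a + j) % n, Nat.mod_lt _ a.pos⟩

theorem cyclicShift_zero {n : ℕ} : (cyclicShift 0 : Fin n → Fin n) = id := by
  funext a
  exact Fin.ext (Nat.mod_eq_of_lt a.isLt)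

theorem cyclicShift_cyclicShift {n : ℕ} (i j : ℕ) (a : Fin n) :
    cyclicShift i (cyclicShift j a) = cyclicShift (j + i) a :=
  Fin.ext (by simp [cyclicShift, add_assoc])

theorem cyclicShift_mod {n : ℕ} (j : ℕ) (a : Fin n) :
    cyclicShift (j % n) a = cyclicShift j a :=
  Fin.ext (by simp [cyclicShift])

theorem cyclicShift_injective {n : ℕ} (j : ℕ) :
    Function.Injective (cyclicShift j : Fin n → Fin n) := fun a b h => by
  have h1 : (a : ℕ) + j ≡ b + j [MOD n] := congrArg Fin.val h
  have h2 := Nat.ModEq.add_right_cancel' j h1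
  exact Fin.ext (by simpa [Nat.ModEq, Nat.mod_eq_of_lt] using h2)

/-- The simultaneous cyclic shift of the row and column indices of indeterminates. -/
def indexShift {X : Type*} {n : ℕ} (j : ℕ) : X × Fin n × Fin n → X × Fin n × Fin n :=
  Prod.map id (Prod.map (cyclicShift j) (cyclicShift j))

theorem indexShift_injective {X : Type*} {n : ℕ} (j : ℕ) :
    Function.Injective (indexShift j : X × Fin n × Fin n → _) :=
  Function.injective_id.prodMap ((cyclicShift_injective j).prodMap (cyclicShift_injective j))

theorem indexShift_zero {X : Type*} {n : ℕ} :
    (indexShift 0 : X × Fin n × Fin n → _) = id := by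
  funext a
  simp [indexShift, cyclicShift_zero]

theorem indexShift_comp {X : Type*} {n : ℕ} (i j : ℕ) :
    (indexShift i ∘ indexShift j : X × Fin n × Fin n → _) = indexShift (j + i) := by
  funext ⟨x, a, b⟩
  simp [indexShift, cyclicShift_cyclicShift]

/-- The semidirect product of the monoid of monomials in the indeterminates `t_{ij}^{(x)}` by `ℕ`,
which acts by cyclic shifts of the indices. -/
@[ext]
structure ShiftMonoid (X : Type*) (n : ℕ) where
  /-- the exponents of the monomial -/
  exps : X × Fin n × Fin n →₀ ℕ
  /-- the power of the shift -/
  deg : ℕ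

namespace ShiftMonoid

variable {X : Type*} {n : ℕ}

noncomputable instance : Mul (ShiftMonoid X n) :=
  ⟨fun a b => ⟨a.exps + b.exps.mapDomain (indexShift a.deg), a.deg + b.deg⟩⟩

instance : One (ShiftMonoid X n) := ⟨⟨0, 0⟩⟩

theorem exps_mul (a b : ShiftMonoid X n) :
    (a * b).exps = a.exps + b.exps.mapDomain (indexShift a.deg) := rfl

theorem deg_mul (a b : ShiftMonoid X n) : (a * b).deg = a.deg + b.deg := rfl

theorem exps_one : (1 : ShiftMonoid X n).exps = 0 := rfl

theorem deg_one : (1 : ShiftMonoid X n).deg = 0 := rfl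

noncomputable instance : Monoid (ShiftMonoid X n) where
  mul_assoc a b c := by
    ext1
    · simp only [exps_mul, deg_mul, Finsupp.mapDomain_add, ← Finsupp.mapDomain_comp,
        indexShift_comp, add_assoc, add_comm b.deg a.deg]
    · simp [deg_mul, add_assoc]
  one_mul a := by
    ext1
    · simp [exps_mul, exps_one, deg_one, indexShift_zero, Finsupp.mapDomain_id]
    · simp [deg_mul, deg_one]
  mul_one a := by
    ext1
    · simp [exps_mul, exps_one]
    · simp [deg_mul, deg_one]

/-- First isolate a unique sum of degrees, then a unique sum of exponents among elements of those
degrees; there the twist is one fixed injective shift. -/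
instance : UniqueProds (ShiftMonoid X n) where
  uniqueMul_of_nonempty {A B} hA hB := by
    classical
    obtain ⟨p, hp, q, hq, hpq⟩ := UniqueSums.uniqueAdd_of_nonempty (hA.image deg) (hB.image deg)
    have hA' : ({a ∈ A | a.deg = p}).Nonempty := by
      obtain ⟨a, ha, rfl⟩ := Finset.mem_image.mp hp
      exact ⟨a, by simp [ha]⟩
    have hB' : ({b ∈ B | b.deg = q}).Nonempty := by
      obtain ⟨b, hb, rfl⟩ := Finset.mem_image.mp hq
      exact ⟨b, by simp [hb]⟩
    obtain ⟨u, hu, v, hv, huv⟩ := UniqueSums.uniqueAdd_of_nonempty (hA'.image exps)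
      (hB'.image fun b => b.exps.mapDomain (indexShift p))
    obtain ⟨a, ha, rfl⟩ := Finset.mem_image.mp hu
    obtain ⟨b, hb, rfl⟩ := Finset.mem_image.mp hv
    obtain ⟨haA, rfl⟩ := Finset.mem_filter.mp ha
    obtain ⟨hbB, rfl⟩ := Finset.mem_filter.mp hb
    refine ⟨a, haA, b, hbB, fun c d hc hd h => ?_⟩
    obtain ⟨h1, h2⟩ := hpq (Finset.mem_image_of_mem _ hc) (Finset.mem_image_of_mem _ hd)
      (congrArg deg h)
    have h3 := congrArg exps h
    rw [exps_mul, exps_mul, h1] at h3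
    obtain ⟨h4, h5⟩ := huv
      (Finset.mem_image_of_mem _ (Finset.mem_filter.mpr ⟨hc, h1⟩))
      (Finset.mem_image_of_mem _ (Finset.mem_filter.mpr ⟨hd, h2⟩)) h3
    exact ⟨ShiftMonoid.ext h4 h1,
      ShiftMonoid.ext (Finsupp.mapDomain_injective (indexShift_injective _) h5) h2⟩

/-- The action of `ShiftMonoid X n` on the indices of `n × n` matrices. -/
noncomputable def monomialAction (X : Type*) (n : ℕ) : MonomialAction (ShiftMonoid X n) (Fin n)
    (Multiplicative ((X × Fin n × Fin n →₀ ℕ) × ℕ)) where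
  act e a := cyclicShift a.deg e
  weight e a := Multiplicative.ofAdd (a.exps.mapDomain (indexShift e), a.deg)
  act_one e := by simp [deg_one, cyclicShift_zero]
  act_mul e a b := by simp [deg_mul, cyclicShift_cyclicShift]
  weight_one e := by simp [exps_one, deg_one]
  weight_mul e a b := by
    have h : (indexShift (cyclicShift a.deg e : ℕ) : X × Fin n × Fin n → _) =
        indexShift (a.deg + e) := by
      funext ⟨x, i, j⟩
      have hs (i : Fin n) : cyclicShift (cyclicShift a.deg e : ℕ) i = cyclicShift (a.deg + e) i := by
        rw [← cyclicShift_mod (a.deg + e), add_comm]; rfl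
      simp [indexShift, hs]
    rw [← ofAdd_add, Prod.mk_add_mk, exps_mul, deg_mul, Finsupp.mapDomain_add,
      ← Finsupp.mapDomain_comp, indexShift_comp, h]

theorem monomialAction_weight_injective (e : Fin n) :
    Function.Injective ((monomialAction X n).weight e) := fun a b h => by
  have h' := Multiplicative.ofAdd.injective h
  exact ShiftMonoid.ext (Finsupp.mapDomain_injective (indexShift_injective _)
    (congrArg Prod.fst h')) (congrArg Prod.snd h')

end ShiftMonoid

/-! ### Embedding the generic matrix algebra -/

section GenericMatrices

variable (F : Type*) [Field F] (X : Type*) (n : ℕ)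

/-- The substitution `t_{ij}^{(x)} ↦ t_{ij}^{(x)} z ^ ((j - i) mod n)`. -/
noncomputable def weightedSubst : MvPolynomial (X × Fin n × Fin n) F →ₐ[F]
    MonoidAlgebra F (Multiplicative ((X × Fin n × Fin n →₀ ℕ) × ℕ)) :=
  MvPolynomial.aeval fun t => MonoidAlgebra.single
    (Multiplicative.ofAdd (Finsupp.single t 1, ((t.2.2 - t.2.1 : Fin n) : ℕ))) 1

/-- Setting `z = 1` is a left inverse. -/
theorem weightedSubst_injective : Function.Injective (weightedSubst F X n) := by
  let ψ : MonoidAlgebra F (Multiplicative ((X × Fin n × Fin n →₀ ℕ) × ℕ)) →ₐ[F]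
      MvPolynomial (X × Fin n × Fin n) F :=
    MonoidAlgebra.lift F _ _
      { toFun u := MvPolynomial.monomial u.toAdd.1 1
        map_one' := rfl
        map_mul' u v := by simp [MvPolynomial.monomial_mul] }
  have h : ψ.comp (weightedSubst F X n) = AlgHom.id F _ := by
    ext1 t
    rw [AlgHom.comp_apply, weightedSubst, MvPolynomial.aeval_X, MonoidAlgebra.lift_single, one_smul]
    rfl
  exact Function.LeftInverse.injective (g := ψ) fun p => DFunLike.congr_fun h p

variable {F X n}

theorem cyclicShift_val [NeZero n] (a b : Fin n) : cyclicShift (b : ℕ) a = a + b :=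
  Fin.ext (Fin.val_add a b).symm

/-- Up to a substitution, the generic matrix is the image of an element of the monoid algebra of
`ShiftMonoid X n`. -/
theorem weightedSubst_genericMatrix_mem_range [NeZero n] (x : X) :
    (weightedSubst F X n).mapMatrix (genericMatrix F n x) ∈
      ((ShiftMonoid.monomialAction X n).rep F).range := by
  refine (AlgHom.mem_range _).mpr
    -- Shifting the row 0 indeterminate `t_{0j}` by `e` gives `t_{e,e+j}`, so the `j`-th term fills
    -- the `j`-th cyclic diagonal.
    ⟨∑ j : Fin n, MonoidAlgebra.single ⟨Finsupp.single (x, 0, j) 1, j⟩ 1, ?_⟩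
  ext1 e e'
  simp only [map_sum, Matrix.sum_apply, MonomialAction.rep_single,
    AlgHom.mapMatrix_apply, Matrix.map_apply, genericMatrix, Matrix.of_apply, weightedSubst,
    MvPolynomial.aeval_X]
  have hact (j : Fin n) : (ShiftMonoid.monomialAction X n).act e
      ⟨Finsupp.single (x, 0, j) 1, j⟩ = e' ↔ j = e' - e := by
    change cyclicShift (j : ℕ) e = e' ↔ _
    rw [cyclicShift_val, eq_sub_iff_add_eq']
  rw [Finset.sum_eq_single (e' - e) (fun j _ hj => if_neg fun h => hj ((hact j).mp h))
    (fun h => absurd (Finset.mem_univ _) h), if_pos ((hact _).mpr rfl)]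
  simp [ShiftMonoid.monomialAction, Finsupp.mapDomain_single, indexShift, cyclicShift_val]

/-- The generic matrix algebra embeds in the monoid algebra of `ShiftMonoid X n`. -/
theorem exists_injective_to_monoidAlgebra [NeZero n] :
    ∃ φ : genericMatrixAlgebra F n X →ₐ[F] MonoidAlgebra F (ShiftMonoid X n),
      Function.Injective φ := by
  have hρ := MonomialAction.rep_injective F (ShiftMonoid.monomialAction X n) 0
    (ShiftMonoid.monomialAction_weight_injective 0)
  have hle : genericMatrixAlgebra F n X ≤
      ((ShiftMonoid.monomialAction X n).rep F).range.comap (weightedSubst F X n).mapMatrix :=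
    Algebra.adjoin_le (by
      rintro _ ⟨x, rfl⟩
      exact weightedSubst_genericMatrix_mem_range x)
  let ψ : genericMatrixAlgebra F n X →ₐ[F] ((ShiftMonoid.monomialAction X n).rep F).range :=
    ((weightedSubst F X n).mapMatrix.comp (genericMatrixAlgebra F n X).val).codRestrict _
      fun a => hle a.2
  refine ⟨(AlgEquiv.ofInjective _ hρ).symm.toAlgHom.comp ψ,
    (AlgEquiv.ofInjective _ hρ).symm.injective.comp ?_⟩
  intro a b h
  exact Subtype.ext (Matrix.map_injective (weightedSubst_injective F X n) (congrArg Subtype.val h))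

end GenericMatrices

/-! ### Tensor products of algebras over a field -/

namespace PiTensorProduct

variable {F ι : Type*} [Field F]

/-- The tensor product of a family of algebra homomorphisms. -/
noncomputable def mapAlgHomOfField {A B : ι → Type*} [∀ i, Ring (A i)] [∀ i, Algebra F (A i)]
    [∀ i, Ring (B i)] [∀ i, Algebra F (B i)] (f : ∀ i, A i →ₐ[F] B i) :
    (⨂[F] i, A i) →ₐ[F] ⨂[F] i, B i :=
  liftAlgHom ((tprod F).compLinearMap fun i => (f i).toLinearMap)
    (by simp [one_def, Pi.one_def])
    (fun x y => by simp [Pi.mul_def])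

/-- Injections over a field split linearly, and the tensor product of the splittings is a left
inverse. -/
theorem mapAlgHomOfField_injective {A B : ι → Type*} [∀ i, Ring (A i)] [∀ i, Algebra F (A i)]
    [∀ i, Ring (B i)] [∀ i, Algebra F (B i)] (f : ∀ i, A i →ₐ[F] B i)
    (hf : ∀ i, Function.Injective (f i)) : Function.Injective (mapAlgHomOfField f) := by
  choose g hg using fun i => (f i).toLinearMap.exists_leftInverse_of_injective
    (LinearMap.ker_eq_bot.mpr (hf i))
  have h : map g ∘ₗ (mapAlgHomOfField f).toLinearMap = LinearMap.id := by
    ext x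
    simp only [mapAlgHomOfField, LinearMap.compMultilinearMap_apply, LinearMap.comp_apply,
      AlgHom.toLinearMap_apply, LinearMap.id_apply]
    erw [lift.tprod]
    simp only [MultilinearMap.compLinearMap_apply, map_tprod]
    congr 1
    funext i
    exact LinearMap.congr_fun (hg i) (x i)
  exact Function.LeftInverse.injective (g := map g) fun a => LinearMap.congr_fun h a

/-- The tensor product of finitely many monoid algebras is the monoid algebra of the product. -/
theorem nonempty_algEquiv_monoidAlgebra [Finite ι] (N : ι → Type*) [∀ i, Monoid (N i)] :
    Nonempty (MonoidAlgebra F (∀ i, N i) ≃ₐ[F] ⨂[F] i, MonoidAlgebra F (N i)) := by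
  let φ : MonoidAlgebra F (∀ i, N i) →ₐ[F] ⨂[F] i, MonoidAlgebra F (N i) :=
    MonoidAlgebra.lift F _ _
      (tprodMonoidHom F |>.comp (MonoidHom.piMap fun i => MonoidAlgebra.of F (N i)))
  let e := (MonoidAlgebra.basis (∀ i, N i) F).equiv
    (Basis.piTensorProduct fun i => MonoidAlgebra.basis (N i) F) (Equiv.refl _)
  have h : φ.toLinearMap = e.toLinearMap := by
    refine (MonoidAlgebra.basis (∀ i, N i) F).ext fun p => ?_
    rw [LinearEquiv.coe_coe, Module.Basis.equiv_apply]
    simp [φ]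
    rfl
  refine ⟨AlgEquiv.ofBijective φ ?_⟩
  have : ⇑φ = ⇑e := congrArg DFunLike.coe h
  rw [this]
  exact e.bijective

end PiTensorProduct

theorem proposition2 {F : Type*} [Field F] [Infinite F] (n : ℕ) (hn : 1 ≤ n)
    (k : ℕ) (X : Fin k → Type*) :
    IsOreDomain (⨂[F] i : Fin k, genericMatrixAlgebra F n (X i)) := by
  have : NeZero n := ⟨by lia⟩
  choose φ hφ using fun i => exists_injective_to_monoidAlgebra (F := F) (X := X i) (n := n)
  obtain ⟨e⟩ := PiTensorProduct.nonempty_algEquiv_monoidAlgebra (F := F)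
    fun i => ShiftMonoid (X i) n
  let ψ := e.symm.toAlgHom.comp (PiTensorProduct.mapAlgHomOfField φ)
  have hψ : Function.Injective ψ :=
    e.symm.injective.comp (PiTensorProduct.mapAlgHomOfField_injective φ hφ)
  have : IsDomain (MonoidAlgebra F (∀ i, ShiftMonoid (X i) n)) := NoZeroDivisors.to_isDomain _
  have := hψ.isDomain ψ.toRingHom
  let α := MonomialAction.pi fun i => ShiftMonoid.monomialAction (X i) n
  have hα : Function.Injective (α.weight 0) := fun a b h => funext fun i =>
    ShiftMonoid.monomialAction_weight_injective _ (congrFun h i)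
  exact isOreDomain_of_injective_matrix ((α.rep F).comp ψ).toRingHom
    ((α.rep_injective F 0 hα).comp hψ)
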